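/- Work in the untyped $\lambda\beta$-calculus. $\Lambda$ is the set of (possibly open) $\lambda$-terms modulo $\alpha$, $=$ is beta conversion, and $M=^\infty N$ means that $M$ and $N$ have the same Böhm tree. Write $z\notin M$ if $z$ is not free in some $N=M$, and $z\notin^\infty M$ if $z$ is not free in some $N=^\infty M$; $F^k(z)$ is $F(\cdots F(z)\cdots)$ with $k$ copies of $F$. A term $Y$ is a fixed point combinator (fpc) if $Yx=x(Yx)$, and a weak fpc (wfpc) if $Yx=^\infty x(Yx)$, for $x$ not free in $Y$. For a finite sequence $\vec G=(G_0,\dots,G_n)$ of terms put $Y\vec G=YG_0\cdots G_n$, and $Y()=Y$. Call $\vec G$ an fgv if $Y\vec G$ is an fpc for every fpc $Y$, and a wfgv if $Y\vec G$ is a wfpc for every wfpc $Y$. Under concatenation (with unit $()$) the fgvs form a monoid $\mathcal F$ and the wfgvs form a monoid $\mathcal G$. Write $\vec G\simeq\vec H$ if $Y\vec G=Y\vec H$ for every fpc $Y$. For $z$ not free in a nonempty vector $\vec G=(G_0,\dots,G_n)$, call $\vec G$ *constant* if $z\notin G_0^k(z)G_1\cdots G_n$ for some $k\ge 0$; *weakly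 constant* if $z\notin^\infty G_0^k(z)G_1\cdots G_n$ for some $k$; *compact* if $G_0^k(z)G_1\cdots G_n$ is an fpc for some $k$; *weakly compact* if $G_0^k(z)G_1\cdots G_n$ is a wfpc for some $k$. The empty vector has none of these properties. A *two-sided ideal* of a monoid $M$ is a set $I\subseteq M$ such that $i\cdot m\in I$ and $m\cdot i\in I$ for all $i\in I$, $m\in M$. **Proposition.** 1. For each of the two monoids $M=\mathcal F$ and $M=\mathcal G$, the constant generators in $M$ form the minimal two-sided ideal of $M$ up to $\simeq$. That is, they form a nonempty two-sided ideal of $M$; this set is closed under $\simeq$ in $M$; and for every nonempty two-sided ideal $I$ of $M$, each constant generator in $M$ is $\simeq$-equal to an element of $I$ (so every nonempty two-sided ideal that is closed under $\simeq$ contains all constant generators). 2. A wfgv is weakly constant if and only if it is weakly compact, and the weakly constant wfgvs form a two-sided ideal in $\mathcal G$. 3. The compact fgvs form a two-sided ideal in $\mathcal F$. They also form a subset of $\mathcal G$ that is closed under multiplication on the left by arbitrary elements of $\mathcal G$: if $\vec H\in\mathcal G$ and $\vec G$ is a compact fgv, then $\vec H\vec G$ is a compact fgv. -/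

import Mathlib

namespace LambdaFP

/-! Untyped lambda terms, in de Bruijn notation. A term may have free variables: under `k` binders
the index `k + n` denotes the free variable number `n`. Terms in this notation are exactly the
usual lambda terms modulo renaming of bound variables. -/

inductive Term : Type
  | var (n : ℕ) : Term
  | app (s t : Term) : Term
  | lam (t : Term) : Term

namespace Term

/-- The set of free variables. -/
def FV : Term → Set ℕ
  | var n => {n}
  | app s t => FV s ∪ FV t
  | lam t => {n | n + 1 ∈ FV t}

/-- Extend a renaming of variables under one binder. -/
def upRen (ρ : ℕ → ℕ) : ℕ → ℕ
  | 0 => 0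
  | n + 1 => ρ n + 1

/-- Rename the free variables. -/
def rename : (ℕ → ℕ) → Term → Term
  | ρ, var n => var (ρ n)
  | ρ, app s t => app (rename ρ s) (rename ρ t)
  | ρ, lam t => lam (rename (upRen ρ) t)

/-- Extend a substitution under one binder. -/
def up (σ : ℕ → Term) : ℕ → Term
  | 0 => var 0
  | n + 1 => rename Nat.succ (σ n)

/-- Simultaneous capture-avoiding substitution of `σ n` for every free variable `n`. -/
def subst : (ℕ → Term) → Term → Term
  | σ, var n => σ n
  | σ, app s t => app (subst σ s) (subst σ t)
  | σ, lam t => lam (subst (up σ) t)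

/-- The substitution that replaces the outermost bound variable of the body of an abstraction
by `a` and lowers all other variables. -/
def single (a : Term) : ℕ → Term
  | 0 => a
  | n + 1 => var n

/-- One-step beta reduction. -/
inductive Step : Term → Term → Prop
  | beta (t a : Term) : Step (app (lam t) a) (subst (single a) t)
  | appL {s s' : Term} (t : Term) : Step s s' → Step (app s t) (app s' t)
  | appR (s : Term) {t t' : Term} : Step t t' → Step (app s t) (app s t')
  | lam {t t' : Term} : Step t t' → Step (lam t) (lam t')

/-- Beta conversion, `M = N` in the lambda calculus. -/
def Conv : Term → Term → Prop := Relation.EqvGen Step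

/-- `M N₁ ⋯ Nₖ`. -/
def apps (M : Term) (Ns : List Term) : Term := Ns.foldl app M

/-- `λ x₁ ⋯ xₙ. M`. -/
def lams (n : ℕ) (M : Term) : Term := lam^[n] M

/-- The identity combinator. -/
def I : Term := lam (var 0)

/-- `M` is solvable if some substitution instance of it, applied to some arguments, is convertible
to the identity. For closed `M` no substitution takes place, and for open `M` this says that the
closure `λ x₁ ⋯ xₘ. M` of `M` is solvable. -/
def Solvable (M : Term) : Prop :=
  ∃ (σ : ℕ → Term) (Ns : List Term), Conv (apps (subst σ M) Ns) I

/-- `M` and `N` have the same Böhm tree. This is the largest relation `R` such that related terms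
are either both unsolvable, or convertible to head normal forms `λ x₁ ⋯ xₙ. y M₁ ⋯ Mₖ` and
`λ x₁ ⋯ xₙ. y N₁ ⋯ Nₖ` with the same binders, the same head variable and related arguments. -/
def BohmEq (M N : Term) : Prop :=
  ∃ R : Term → Term → Prop,
    (∀ P Q, R P Q →
      (¬ Solvable P ∧ ¬ Solvable Q) ∨
      ∃ (n y : ℕ) (Ps Qs : List Term),
        Conv P (lams n (apps (var y) Ps)) ∧ Conv Q (lams n (apps (var y) Qs)) ∧
          List.Forall₂ R Ps Qs) ∧
    R M N

/-- `z ∉ M`: the variable `z` can be removed from `M` by conversion. -/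
def NotIn (z : ℕ) (M : Term) : Prop := ∃ N, Conv N M ∧ z ∉ FV N

/-- `z ∉^∞ M`: some term with the same Böhm tree as `M` does not contain `z`. -/
def NotInInf (z : ℕ) (M : Term) : Prop := ∃ N, BohmEq N M ∧ z ∉ FV N

end Term

open Term

/-- Fixed point combinators: `Y x = x (Y x)` for `x` not free in `Y`. -/
def FPC : Set Term :=
  {Y | ∀ x, x ∉ FV Y → Conv (app Y (var x)) (app (var x) (app Y (var x)))}

/-- Weak fixed point combinators: `Y x` and `x (Y x)` have the same Böhm tree. -/
def WFPC : Set Term :=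
  {Y | ∀ x, x ∉ FV Y → BohmEq (app Y (var x)) (app (var x) (app Y (var x)))}

/-- Vectors (finite sequences) of terms. Their product is concatenation, and `1` is the empty
vector. -/
abbrev Vec : Type := FreeMonoid Term

/-- `Y G₀ ⋯ Gₙ`. -/
def act (Y : Term) (G : Vec) : Term := apps Y G.toList

theorem act_one (Y : Term) : act Y 1 = Y := rfl

theorem act_mul (Y : Term) (G H : Vec) : act Y (G * H) = act (act Y G) H := by
  simp [act, apps, FreeMonoid.toList_mul, List.foldl_append]

/-- The monoid of fpc generating vectors. -/
def fgv : Submonoid Vec where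
  carrier := {G | ∀ Y ∈ FPC, act Y G ∈ FPC}
  one_mem' := fun Y hY => hY
  mul_mem' := fun {G H} hG hH Y hY => by
    rw [act_mul]
    exact hH _ (hG Y hY)

/-- The monoid of weak fpc generating vectors. -/
def wfgv : Submonoid Vec where
  carrier := {G | ∀ Y ∈ WFPC, act Y G ∈ WFPC}
  one_mem' := fun Y hY => hY
  mul_mem' := fun {G H} hG hH Y hY => by
    rw [act_mul]
    exact hH _ (hG Y hY)

/-- Extensional equality of generators: the same values on all fixed point combinators. -/
def ExtEq (G H : Vec) : Prop := ∀ Y ∈ FPC, Conv (act Y G) (act Y H)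

/-- For `G = (G₀, …, Gₙ)`: there is a `k` such that the term `G₀ᵏ(z) G₁ ⋯ Gₙ` has the property
`P z`, for `z` not free in `G`. The empty vector has no entry `G₀`, and does not qualify. -/
def Truncation (P : ℕ → Term → Prop) (G : Vec) : Prop :=
  ∃ (G₀ : Term) (Gs : List Term), G.toList = G₀ :: Gs ∧
    ∃ k : ℕ, ∀ z : ℕ, (∀ A ∈ G.toList, z ∉ FV A) → P z (apps ((app G₀)^[k] (var z)) Gs)

/-- `z ∉ G₀ᵏ(z) G₁ ⋯ Gₙ` for some `k`. -/
def IsConstant (G : Vec) : Prop := Truncation NotIn G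

/-- `z ∉^∞ G₀ᵏ(z) G₁ ⋯ Gₙ` for some `k`. -/
def IsWeaklyConstant (G : Vec) : Prop := Truncation NotInInf G

/-- `G₀ᵏ(z) G₁ ⋯ Gₙ` is an fpc for some `k`. -/
def IsCompactGen (G : Vec) : Prop := Truncation (fun _ M => M ∈ FPC) G

/-- `G₀ᵏ(z) G₁ ⋯ Gₙ` is a weak fpc for some `k`. -/
def IsWeaklyCompactGen (G : Vec) : Prop := Truncation (fun _ M => M ∈ WFPC) G

/-- `J` is a subset of the monoid `M` that is closed under multiplication by elements of `M` on the
left: `m * i ∈ J` for `m ∈ M` and `i ∈ J`. -/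
def AbsorbsLeft (M : Submonoid Vec) (J : Set Vec) : Prop :=
  J ⊆ M ∧ ∀ m ∈ M, ∀ i ∈ J, m * i ∈ J

/-- Two-sided ideals of the monoid `M`. -/
def IsTwoSidedIdeal (M : Submonoid Vec) (J : Set Vec) : Prop :=
  J ⊆ M ∧ ∀ i ∈ J, ∀ m ∈ M, i * m ∈ J ∧ m * i ∈ J

/-- `J` is the minimal (that is, the least nonempty) two-sided ideal of `M` up to extensional
equality: it is a nonempty two-sided ideal, a union of classes of extensional equality in `M`, and
each of its elements is extensionally equal to an element of any given nonempty two-sided ideal. In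
particular it is contained in every nonempty two-sided ideal that is a union of such classes. -/
def IsMinimalIdeal (M : Submonoid Vec) (J : Set Vec) : Prop :=
  IsTwoSidedIdeal M J ∧ J.Nonempty ∧ (∀ G ∈ J, ∀ H ∈ M, ExtEq G H → H ∈ J) ∧
    ∀ J' : Set Vec, IsTwoSidedIdeal M J' → J'.Nonempty → ∀ G ∈ J, ∃ H ∈ J', ExtEq H G

end LambdaFP

/-!
A weak fixed point combinator `Y` satisfies `Y G₀ = G₀ᵏ(M)` for every `k` and some `M` depending on
`k` (`WFPC_app_conv`). Hence `Y G₀ ⋯ Gₙ` is a substitution instance of each of the truncations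
`G₀ᵏ(z) G₁ ⋯ Gₙ`, and a property of a truncation that is stable under substitution passes to all
values of the generator. This gives one half of every assertion. In particular a constant generator
takes the same value at all weak fixed point combinators.

The other half is to recover a truncation from the values. For this, take the fixed point combinator
`genFPC z = λ f. w f z w` with `w = λ f p x. f (x f p x)`: it carries a variable `z` along that is
never used. Complete developments commute with substitutions that create no redexes (`dev_subst`),
and three of them turn a loop `w F z w` into a reduct of `F v` with another loop in place of `v`
(`dev_dev_dev_loop`). As complete development is a cofinal strategy, each reduction of `C[w F z w]`
can be continued to an instance, with a loop in place of `v`, of a reduct of `C[Fᵐ(v)]`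
(`exists_approx`). This has two consequences.

* If the value of `H` at `genFPC z` is convertible to a term without `z`, then the hole `v` has
  disappeared from that reduct, so that `H` is constant (`isConstant_of_genFPC`). Thus a nonempty
  vector is constant exactly if it takes the same value at all fixed point combinators
  (`isConstant_iff`), and the assertions on constant generators become formal.
* If the value of `L` at `genFPC z` is a weak fixed point combinator, then long truncations of `L`,
  applied to `G₀`, produce any number of copies of `G₀` (`exists_unfolding_conv`). So a truncation
  of `L G` is an instance of a given truncation of `G`, and compactness is inherited from `G`
  (`truncation_mul_left`).

Weak constancy and weak compactness are compared without using that equality of Böhm trees is a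
congruence. A weak fixed point combinator is a term `Y` for which `Y x` has the Böhm tree
`x (x (x ⋯))`, so all of them have the same Böhm tree (`WFPC_bohmEq`), and a weakly compact
truncation has the Böhm tree of an instance without `z`. Conversely, suppose that `z` is absent from
the Böhm tree of a truncation `T`. Some instance `T[z := M]` is a weak fixed point combinator; along
the path `λ x. x (x (x ⋯))` the head variables of `T` are not `z`, so they are not affected by the
substitution, and `T` itself is a weak fixed point combinator (`mem_WFPC_of_subst`).
-/

namespace LambdaFP
namespace Term

/-! ### Renaming and substitution -/

theorem rename_rename (t : Term) (ρ ρ' : ℕ → ℕ) :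
    rename ρ' (rename ρ t) = rename (ρ' ∘ ρ) t := by
  induction t generalizing ρ ρ' with
  | var n => rfl
  | app s t ihs iht => simp [rename, ihs, iht]
  | lam t ih =>
    have h : upRen ρ' ∘ upRen ρ = upRen (ρ' ∘ ρ) := by funext n; cases n <;> rfl
    simp [rename, ih, h]

theorem subst_rename (t : Term) (ρ : ℕ → ℕ) (σ : ℕ → Term) :
    subst σ (rename ρ t) = subst (σ ∘ ρ) t := by
  induction t generalizing ρ σ with
  | var n => rfl
  | app s t ihs iht => simp [rename, subst, ihs, iht]
  | lam t ih =>
    have h : up σ ∘ upRen ρ = up (σ ∘ ρ) := by funext n; cases n <;> rfl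
    simp [rename, subst, ih, h]

theorem rename_subst (t : Term) (σ : ℕ → Term) (ρ : ℕ → ℕ) :
    rename ρ (subst σ t) = subst (fun n => rename ρ (σ n)) t := by
  induction t generalizing ρ σ with
  | var n => rfl
  | app s t ihs iht => simp [rename, subst, ihs, iht]
  | lam t ih =>
    have h : (fun n => rename (upRen ρ) (up σ n)) = up (fun n => rename ρ (σ n)) := by
      funext n
      cases n with
      | zero => rfl
      | succ n => simp only [up, rename_rename]; rfl
    simp [rename, subst, ih, h]

theorem subst_subst (t : Term) (σ τ : ℕ → Term) :
    subst τ (subst σ t) = subst (fun n => subst τ (σ n)) t := by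
  induction t generalizing σ τ with
  | var n => rfl
  | app s t ihs iht => simp [subst, ihs, iht]
  | lam t ih =>
    have h : (fun n => subst (up τ) (up σ n)) = up (fun n => subst τ (σ n)) := by
      funext n
      cases n with
      | zero => rfl
      | succ n => simp only [up, subst_rename, rename_subst]; rfl
    simp [subst, ih, h]

theorem up_var : up var = var := by funext n; cases n <;> rfl

theorem subst_var (t : Term) : subst var t = t := by
  induction t with
  | var n => rfl
  | app s t ihs iht => simp [subst, ihs, iht]
  | lam t ih => simp [subst, up_var, ih]

theorem rename_eq_subst (t : Term) (ρ : ℕ → ℕ) : rename ρ t = subst (fun n => var (ρ n)) t := by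
  have h := rename_subst t var ρ
  rwa [subst_var] at h

theorem subst_congr {t : Term} {σ τ : ℕ → Term} (h : ∀ n ∈ FV t, σ n = τ n) :
    subst σ t = subst τ t := by
  induction t generalizing σ τ with
  | var n => exact h n rfl
  | app s t ihs iht =>
    simp only [subst]
    rw [ihs fun n hn => h n (Or.inl hn), iht fun n hn => h n (Or.inr hn)]
  | lam t ih =>
    simp only [subst]
    rw [ih fun n hn => ?_]
    cases n with
    | zero => rfl
    | succ n => simp only [up]; rw [h n hn]

theorem mem_FV_subst {t : Term} {σ : ℕ → Term} {n : ℕ} :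
    n ∈ FV (subst σ t) ↔ ∃ m ∈ FV t, n ∈ FV (σ m) := by
  have hren : ∀ (t : Term) (ρ : ℕ → ℕ) (n : ℕ), n ∈ FV (rename ρ t) ↔ ∃ m ∈ FV t, ρ m = n := by
    intro t
    induction t with
    | var m => intro ρ n; simp [rename, FV, eq_comm]
    | app s t ihs iht => intro ρ n; simp [rename, FV, ihs, iht, or_and_right, exists_or]
    | lam t ih =>
      intro ρ n
      simp only [rename, FV, Set.mem_ofPred_eq, ih]
      constructor
      · rintro ⟨m | m, hm, he⟩
        · simp [upRen] at he
        · exact ⟨m, hm, by simpa [upRen] using he⟩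
      · rintro ⟨m, hm, rfl⟩
        exact ⟨m + 1, hm, rfl⟩
  induction t generalizing σ n with
  | var m => simp [subst, FV]
  | app s t ihs iht => simp [subst, FV, ihs, iht, or_and_right, exists_or]
  | lam t ih =>
    simp only [subst, FV, Set.mem_ofPred_eq, ih]
    constructor
    · rintro ⟨m | m, hm, he⟩
      · simp [up, FV] at he
      · obtain ⟨k, hk, hkn⟩ := (hren _ _ _).1 he
        exact ⟨m, hm, by rwa [← Nat.succ.inj hkn]⟩
    · rintro ⟨m, hm, he⟩
      exact ⟨m + 1, hm, (hren _ _ _).2 ⟨n, he, rfl⟩⟩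

theorem finite_FV (t : Term) : (FV t).Finite := by
  induction t with
  | var n => exact Set.finite_singleton n
  | app s t ihs iht => exact ihs.union iht
  | lam t ih => exact ih.preimage (Nat.succ_injective.injOn)

/-- Finitely many terms leave a variable unused. -/
theorem exists_fresh (l : List Term) : ∃ x, ∀ t ∈ l, x ∉ FV t := by
  have h : (⋃ t ∈ l, FV t).Finite :=
    Set.Finite.biUnion (List.finite_toSet l) fun t _ => finite_FV t
  obtain ⟨x, hx⟩ := h.exists_notMem
  exact ⟨x, fun t ht hxt => hx (Set.mem_biUnion ht hxt)⟩

theorem subst_update_of_notMem {x : ℕ} {t : Term} (hx : x ∉ FV t) (σ : ℕ → Term) (a : Term) :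
    subst (Function.update σ x a) t = subst σ t :=
  subst_congr fun _ hn => Function.update_of_ne (ne_of_mem_of_not_mem hn hx) _ _

theorem subst_update_var_of_notMem {x : ℕ} {t : Term} (hx : x ∉ FV t) (a : Term) :
    subst (Function.update var x a) t = t := by
  rw [subst_update_of_notMem hx, subst_var]

theorem subst_update_app_var {x : ℕ} {t : Term} (hx : x ∉ FV t) (σ : ℕ → Term) (a : Term) :
    subst (Function.update σ x a) (app t (var x)) = app (subst σ t) a := by
  simp only [subst]
  rw [subst_update_of_notMem hx, Function.update_self]

theorem subst_single_rename (t a : Term) : subst (single a) (rename Nat.succ t) = t := by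
  rw [subst_rename]
  exact subst_var t

theorem subst_up_rename (σ : ℕ → Term) (t : Term) :
    subst (up σ) (rename Nat.succ t) = rename Nat.succ (subst σ t) := by
  rw [subst_rename, rename_subst]
  rfl

theorem subst_update_subst_update (v : ℕ) (a b t : Term) :
    subst (Function.update var v a) (subst (Function.update var v b) t) =
      subst (Function.update var v (subst (Function.update var v a) b)) t := by
  rw [subst_subst]
  congr 1
  funext n
  by_cases hn : n = v
  · subst hn; simp
  · simp [hn, subst]

theorem rename_subst_single (ρ : ℕ → ℕ) (t a : Term) :
    rename ρ (subst (single a) t) = subst (single (rename ρ a)) (rename (upRen ρ) t) := by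
  rw [rename_subst, subst_rename]
  congr 1
  funext n
  cases n <;> rfl

theorem subst_apps (σ : ℕ → Term) (M : Term) (Ns : List Term) :
    subst σ (apps M Ns) = apps (subst σ M) (Ns.map (subst σ)) := by
  induction Ns generalizing M with
  | nil => rfl
  | cons N Ns ih => exact ih (app M N)

theorem subst_iterate_app (σ : ℕ → Term) (F M : Term) (k : ℕ) :
    subst σ ((app F)^[k] M) = (app (subst σ F))^[k] (subst σ M) := by
  induction k with
  | zero => rfl
  | succ k ih => rw [Function.iterate_succ_apply', Function.iterate_succ_apply', ← ih]; rfl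

theorem mem_FV_apps {n : ℕ} {M : Term} {Ns : List Term} :
    n ∈ FV (apps M Ns) ↔ n ∈ FV M ∨ ∃ N ∈ Ns, n ∈ FV N := by
  induction Ns generalizing M with
  | nil => simp [apps]
  | cons N Ns ih =>
    have h := ih (M := app M N)
    simp only [apps, List.foldl_cons] at h ⊢
    rw [h]
    simp [FV, or_assoc]

theorem mem_FV_lams {n k : ℕ} {M : Term} : k ∈ FV (lams n M) ↔ k + n ∈ FV M := by
  induction n generalizing k with
  | zero => rfl
  | succ n ih =>
    rw [lams, Function.iterate_succ_apply']
    refine (ih (k := k + 1)).trans ?_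
    rw [Nat.add_right_comm, Nat.add_assoc]

/-! ### Reduction, complete developments and confluence -/

/-- Reduction in any number of steps. -/
abbrev Steps : Term → Term → Prop := Relation.ReflTransGen Step

theorem Steps.appL {s s' : Term} (h : Steps s s') (t : Term) : Steps (app s t) (app s' t) :=
  h.lift (fun s => app s t) fun _ _ => Step.appL t

theorem Steps.appR (s : Term) {t t' : Term} (h : Steps t t') : Steps (app s t) (app s t') :=
  h.lift (app s) fun _ _ => Step.appR s

theorem Steps.app {s s' t t' : Term} (hs : Steps s s') (ht : Steps t t') :
    Steps (app s t) (app s' t') :=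
  (hs.appL t).trans (ht.appR s')

theorem Steps.lam {t t' : Term} (h : Steps t t') : Steps (lam t) (lam t') :=
  h.lift Term.lam fun _ _ => Step.lam

theorem subst_up_subst_single (t a : Term) (σ : ℕ → Term) :
    subst (single (subst σ a)) (subst (up σ) t) = subst σ (subst (single a) t) := by
  rw [subst_subst, subst_subst]
  congr 1
  funext n
  cases n with
  | zero => rfl
  | succ n => exact subst_single_rename _ _

theorem Step.subst {s t : Term} (h : Step s t) (σ : ℕ → Term) :
    Step (subst σ s) (subst σ t) := by
  induction h generalizing σ with
  | beta t a => rw [← subst_up_subst_single]; exact Step.beta _ _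
  | appL t _ ih => exact Step.appL _ (ih σ)
  | appR s _ ih => exact Step.appR _ (ih σ)
  | lam _ ih => exact Step.lam (ih _)

theorem Steps.subst {s t : Term} (h : Steps s t) (σ : ℕ → Term) :
    Steps (subst σ s) (subst σ t) :=
  h.lift (Term.subst σ) fun _ _ h => h.subst σ

theorem Steps.subst_pointwise {σ τ : ℕ → Term} (h : ∀ n, Steps (σ n) (τ n)) (t : Term) :
    Steps (Term.subst σ t) (Term.subst τ t) := by
  induction t generalizing σ τ with
  | var n => exact h n
  | app s t ihs iht => exact (ihs h).app (iht h)
  | lam t ih =>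
    refine (ih fun n => ?_).lam
    cases n with
    | zero => exact .refl
    | succ n =>
      simp only [up, rename_eq_subst]
      exact (h n).subst _

theorem Steps.subst_update {a b : Term} (h : Steps a b) (v : ℕ) (t : Term) :
    Steps (Term.subst (Function.update Term.var v a) t)
      (Term.subst (Function.update Term.var v b) t) := by
  refine Steps.subst_pointwise (fun n => ?_) t
  by_cases hn : n = v
  · subst hn; simpa using h
  · simpa [hn] using Relation.ReflTransGen.refl

theorem Steps.iterate_app {F F' : Term} (h : Steps F F') (M : Term) (k : ℕ) :
    Steps ((Term.app F)^[k] M) ((Term.app F')^[k] M) := by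
  induction k with
  | zero => exact .refl
  | succ k ih =>
    rw [Function.iterate_succ_apply', Function.iterate_succ_apply']
    exact h.app ih

theorem Step.FV_subset {s t : Term} (h : Step s t) : FV t ⊆ FV s := by
  induction h with
  | beta t a =>
    intro n hn
    obtain ⟨m | m, hm, hnm⟩ := mem_FV_subst.1 hn
    · exact Or.inr hnm
    · refine Or.inl ?_
      rw [show n = m from hnm]
      exact hm
  | appL t _ ih => exact Set.union_subset_union_left _ ih
  | appR s _ ih => exact Set.union_subset_union_right _ ih
  | lam _ ih => exact fun n hn => ih hn

theorem Steps.FV_subset {s t : Term} (h : Steps s t) : FV t ⊆ FV s := by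
  induction h with
  | refl => exact subset_rfl
  | tail _ h ih => exact h.FV_subset.trans ih

/-- Parallel reduction: any set of redexes of a term is contracted at once. -/
inductive Par : Term → Term → Prop
  | var (n : ℕ) : Par (var n) (var n)
  | app {s s' t t' : Term} : Par s s' → Par t t' → Par (app s t) (app s' t')
  | lam {t t' : Term} : Par t t' → Par (lam t) (lam t')
  | beta {t t' a a' : Term} : Par t t' → Par a a' →
      Par (app (lam t) a) (Term.subst (single a') t')

theorem Par.refl (t : Term) : Par t t := by
  induction t with
  | var n => exact .var n
  | app s t ihs iht => exact .app ihs iht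
  | lam t ih => exact .lam ih

theorem Step.par {s t : Term} (h : Step s t) : Par s t := by
  induction h with
  | beta t a => exact .beta (.refl _) (.refl _)
  | appL t _ ih => exact .app ih (.refl _)
  | appR s _ ih => exact .app (.refl _) ih
  | lam _ ih => exact .lam ih

theorem Par.steps {s t : Term} (h : Par s t) : Steps s t := by
  induction h with
  | var n => exact .refl
  | app _ _ ihs iht => exact ihs.app iht
  | lam _ ih => exact ih.lam
  | beta _ _ iht iha => exact (iht.lam.app iha).tail (.beta _ _)

theorem Par.rename {s t : Term} (h : Par s t) (ρ : ℕ → ℕ) :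
    Par (rename ρ s) (rename ρ t) := by
  induction h generalizing ρ with
  | var n => exact .refl _
  | app _ _ ihs iht => exact .app (ihs ρ) (iht ρ)
  | lam _ ih => exact .lam (ih _)
  | beta _ _ iht iha =>
    rw [rename_subst_single]
    exact .beta (iht _) (iha ρ)

theorem Par.subst {s t : Term} (h : Par s t) {σ τ : ℕ → Term} (hσ : ∀ n, Par (σ n) (τ n)) :
    Par (subst σ s) (subst τ t) := by
  have hup : ∀ {σ τ : ℕ → Term}, (∀ n, Par (σ n) (τ n)) → ∀ n, Par (up σ n) (up τ n) := by
    intro σ τ h n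
    cases n with
    | zero => exact .refl _
    | succ n => exact (h n).rename _
  induction h generalizing σ τ with
  | var n => exact hσ n
  | app _ _ ihs iht => exact .app (ihs hσ) (iht hσ)
  | lam _ ih => exact .lam (ih (hup hσ))
  | beta _ _ iht iha =>
    rw [← subst_up_subst_single]
    exact .beta (iht (hup hσ)) (iha hσ)

/-- The complete development: all redexes of a term are contracted at once. -/
def dev : Term → Term
  | var n => var n
  | lam t => lam (dev t)
  | app (lam t) a => subst (single (dev a)) (dev t)
  | app (var n) a => app (var n) (dev a)
  | app (app s t) a => app (dev (app s t)) (dev a)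

/-- The term is an abstraction. -/
def IsLam : Term → Prop
  | lam _ => True
  | _ => False

theorem dev_app {s : Term} (hs : ¬ IsLam s) (t : Term) : dev (app s t) = app (dev s) (dev t) := by
  cases s with
  | var n => simp [dev]
  | app _ _ => simp [dev]
  | lam _ => exact absurd trivial hs

/-- Takahashi's triangle property, which yields confluence. -/
theorem Par.dev {s t : Term} (h : Par s t) : Par t (dev s) := by
  induction h with
  | var n => exact .var n
  | lam _ ih => exact .lam ih
  | beta _ _ iht iha =>
    refine iht.subst fun n => ?_
    cases n with
    | zero => exact iha
    | succ n => exact .refl _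
  | @app s s' t t' hs ht ihs iht =>
    by_cases hl : IsLam s
    · cases s with
      | lam u =>
        cases hs with
        | lam hu =>
          cases ihs with
          | lam hu' => exact .beta hu' iht
      | var n => exact hl.elim
      | app _ _ => exact hl.elim
    · rw [dev_app hl]
      exact .app ihs iht

theorem steps_dev (t : Term) : Steps t (dev t) := (Par.refl t).dev.steps

theorem steps_iterate_dev (t : Term) (m : ℕ) : Steps t (dev^[m] t) := by
  induction m with
  | zero => exact .refl
  | succ m ih => rw [Function.iterate_succ_apply']; exact ih.trans (steps_dev _)

theorem Steps.dev {s t : Term} (h : Steps s t) : Steps (dev s) (dev t) := by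
  induction h with
  | refl => exact .refl
  | tail _ h ih => exact ih.trans h.par.dev.dev.steps

/-- Iterated complete development is a cofinal reduction strategy. -/
theorem Steps.exists_iterate_dev {s t : Term} (h : Steps s t) :
    ∃ m₀, ∀ m ≥ m₀, Steps t (Term.dev^[m] s) := by
  induction h with
  | refl => exact ⟨0, fun m _ => steps_iterate_dev _ _⟩
  | tail _ h ih =>
    obtain ⟨m₀, ih⟩ := ih
    refine ⟨m₀ + 1, fun m hm => ?_⟩
    obtain ⟨m, rfl⟩ : ∃ k, m = k + 1 := ⟨m - 1, by omega⟩
    rw [Function.iterate_succ_apply']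
    exact h.par.dev.steps.trans (ih m (by omega)).dev

theorem Steps.confluent {s t u : Term} (ht : Steps s t) (hu : Steps s u) :
    ∃ r, Steps t r ∧ Steps u r := by
  obtain ⟨m, hm⟩ := ht.exists_iterate_dev
  obtain ⟨n, hn⟩ := hu.exists_iterate_dev
  exact ⟨_, hm (max m n) (le_max_left _ _), hn _ (le_max_right _ _)⟩

/-! ### Conversion -/

theorem Conv.refl (t : Term) : Conv t t := Relation.EqvGen.refl t

theorem Conv.symm {s t : Term} (h : Conv s t) : Conv t s := Relation.EqvGen.symm _ _ h

theorem Conv.trans {s t u : Term} (h : Conv s t) (h' : Conv t u) : Conv s u :=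
  Relation.EqvGen.trans _ _ _ h h'

theorem Steps.conv {s t : Term} (h : Steps s t) : Conv s t := by
  induction h with
  | refl => exact .refl _
  | tail _ h ih => exact ih.trans (.rel _ _ h)

/-- The Church-Rosser theorem. -/
theorem Conv.exists_steps {s t : Term} (h : Conv s t) : ∃ r, Steps s r ∧ Steps t r := by
  induction h with
  | rel s t h => exact ⟨t, .single h, .refl⟩
  | refl s => exact ⟨s, .refl, .refl⟩
  | symm s t _ ih => obtain ⟨r, h, h'⟩ := ih; exact ⟨r, h', h⟩
  | trans s t u _ _ ih ih' =>
    obtain ⟨r, h₁, h₂⟩ := ih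
    obtain ⟨r', h₃, h₄⟩ := ih'
    obtain ⟨q, h₅, h₆⟩ := h₂.confluent h₃
    exact ⟨q, h₁.trans h₅, h₄.trans h₆⟩

theorem Conv.lift {s t : Term} (h : Conv s t) {f : Term → Term}
    (hf : ∀ {s t}, Step s t → Step (f s) (f t)) : Conv (f s) (f t) := by
  induction h with
  | rel s t h => exact .rel _ _ (hf h)
  | refl s => exact .refl _
  | symm s t _ ih => exact ih.symm
  | trans s t u _ _ ih ih' => exact ih.trans ih'

theorem Conv.app {s s' t t' : Term} (hs : Conv s s') (ht : Conv t t') :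
    Conv (app s t) (app s' t') :=
  (hs.lift (f := fun s => Term.app s t) (Step.appL t)).trans (ht.lift (Step.appR s'))

theorem Conv.lam {t t' : Term} (h : Conv t t') : Conv (lam t) (lam t') := h.lift Step.lam

theorem Conv.subst {s t : Term} (h : Conv s t) (σ : ℕ → Term) :
    Conv (subst σ s) (subst σ t) := h.lift fun h => h.subst σ

theorem Conv.apps {s t : Term} (h : Conv s t) (Ns : List Term) : Conv (apps s Ns) (apps t Ns) := by
  induction Ns generalizing s t with
  | nil => exact h
  | cons N Ns ih => exact ih (h.app (.refl N))

/-! ### Head normal forms -/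

theorem apps_concat (M : Term) (Ns : List Term) (N : Term) :
    apps M (Ns ++ [N]) = app (apps M Ns) N := by
  simp [apps]

theorem apps_var_ne_lam {y : ℕ} {Ps : List Term} {t : Term} : apps (var y) Ps ≠ lam t := by
  induction Ps using List.reverseRecOn with
  | nil => simp [apps]
  | append_singleton Ps P _ => simp [apps_concat]

theorem apps_var_inj {y z : ℕ} {Ps Qs : List Term} (h : apps (var y) Ps = apps (var z) Qs) :
    y = z ∧ Ps = Qs := by
  induction Ps using List.reverseRecOn generalizing Qs with
  | nil =>
    cases Qs using List.reverseRecOn with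
    | nil => exact ⟨var.inj h, rfl⟩
    | append_singleton Qs Q => simp [apps] at h
  | append_singleton Ps P ih =>
    cases Qs using List.reverseRecOn with
    | nil => simp [apps] at h
    | append_singleton Qs Q =>
      simp only [apps_concat, app.injEq] at h
      obtain ⟨rfl, rfl⟩ := ih h.1
      exact ⟨rfl, by rw [h.2]⟩

theorem lams_apps_inj {n m y z : ℕ} {Ps Qs : List Term}
    (h : lams n (apps (var y) Ps) = lams m (apps (var z) Qs)) : n = m ∧ y = z ∧ Ps = Qs := by
  induction n generalizing m with
  | zero =>
    cases m with
    | zero => exact ⟨rfl, apps_var_inj h⟩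
    | succ m =>
      simp only [lams, Function.iterate_succ_apply'] at h
      exact absurd h apps_var_ne_lam
  | succ n ih =>
    cases m with
    | zero =>
      simp only [lams, Function.iterate_succ_apply'] at h
      exact absurd h.symm apps_var_ne_lam
    | succ m =>
      rw [lams, lams, Function.iterate_succ_apply', Function.iterate_succ_apply', lam.injEq] at h
      obtain ⟨hnm, hyz⟩ := ih h
      exact ⟨by rw [hnm], hyz⟩

theorem Step.of_apps_var {y : ℕ} {Ps : List Term} {t : Term} (h : Step (apps (var y) Ps) t) :
    ∃ Qs, t = apps (var y) Qs ∧ List.Forall₂ Steps Ps Qs := by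
  induction Ps using List.reverseRecOn generalizing t with
  | nil => cases h
  | append_singleton Ps P ih =>
    rw [apps_concat] at h
    have hrefl : List.Forall₂ Steps Ps Ps := List.forall₂_same.2 fun _ _ => .refl
    generalize hM : apps (var y) Ps = M at h
    cases h with
    | beta t a => exact absurd hM apps_var_ne_lam
    | appL _ h =>
      subst hM
      obtain ⟨Qs, rfl, hQ⟩ := ih h
      exact ⟨Qs ++ [P], (apps_concat _ _ _).symm,
        List.rel_append hQ (.cons .refl .nil)⟩
    | @appR _ _ P' h =>
      subst hM
      exact ⟨Ps ++ [P'], (apps_concat _ _ _).symm,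
        List.rel_append hrefl (.cons (.single h) .nil)⟩

theorem Step.of_lams_apps {n y : ℕ} {Ps : List Term} {t : Term}
    (h : Step (lams n (apps (var y) Ps)) t) :
    ∃ Qs, t = lams n (apps (var y) Qs) ∧ List.Forall₂ Steps Ps Qs := by
  induction n generalizing t with
  | zero => exact h.of_apps_var
  | succ n ih =>
    simp only [lams, Function.iterate_succ_apply'] at h ⊢
    cases h with
    | lam h =>
      obtain ⟨Qs, rfl, hQ⟩ := ih h
      exact ⟨Qs, rfl, hQ⟩

theorem forall₂_comp {α : Type*} {R S T : α → α → Prop} (h : ∀ a b c, R a b → S b c → T a c)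
    {k l m : List α} (hR : List.Forall₂ R k l) (hS : List.Forall₂ S l m) :
    List.Forall₂ T k m := by
  induction hR generalizing m with
  | nil => cases hS; exact .nil
  | cons hab _ ih =>
    cases hS with
    | cons hbc hS => exact .cons (h _ _ _ hab hbc) (ih hS)

/-- Reduction of a head normal form takes place inside the arguments of the head variable. -/
theorem Steps.of_lams_apps {n y : ℕ} {Ps : List Term} {t : Term}
    (h : Steps (lams n (apps (var y) Ps)) t) :
    ∃ Qs, t = lams n (apps (var y) Qs) ∧ List.Forall₂ Steps Ps Qs := by
  induction h with
  | refl => exact ⟨Ps, rfl, List.forall₂_same.2 fun _ _ => .refl⟩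
  | tail _ h ih =>
    obtain ⟨Qs, rfl, hQ⟩ := ih
    obtain ⟨Rs, rfl, hR⟩ := h.of_lams_apps
    exact ⟨Rs, rfl, forall₂_comp (R := Steps) (S := Steps) (T := Steps)
      (fun _ _ _ => Relation.ReflTransGen.trans) hQ hR⟩

/-- Convertible head normal forms have the same shape. -/
theorem Conv.lams_apps_inj {n m y z : ℕ} {Ps Qs : List Term}
    (h : Conv (lams n (Term.apps (var y) Ps)) (lams m (Term.apps (var z) Qs))) :
    n = m ∧ y = z ∧ List.Forall₂ Conv Ps Qs := by
  obtain ⟨r, hP, hQ⟩ := h.exists_steps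
  obtain ⟨Rs, rfl, hPR⟩ := hP.of_lams_apps
  obtain ⟨Rs', hr, hQR⟩ := hQ.of_lams_apps
  obtain ⟨rfl, rfl, rfl⟩ := Term.lams_apps_inj hr
  exact ⟨rfl, rfl, forall₂_comp (R := Steps) (S := fun a b => Steps b a) (T := Conv)
    (fun _ _ _ h h' => h.conv.trans h'.conv.symm) hPR hQR.flip⟩

theorem Conv.app_var_inj {x : ℕ} {A B : Term}
    (h : Conv (Term.app (var x) A) (Term.app (var x) B)) : Conv A B := by
  have h' : Conv (lams 0 (Term.apps (var x) [A])) (lams 0 (Term.apps (var x) [B])) := h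
  obtain ⟨-, -, h⟩ := h'.lams_apps_inj
  cases h with
  | cons h _ => exact h

theorem subst_lams (n : ℕ) (σ : ℕ → Term) (M : Term) :
    subst σ (lams n M) = lams n (subst (up^[n] σ) M) := by
  induction n generalizing σ with
  | zero => rfl
  | succ n ih =>
    simp only [lams, Function.iterate_succ_apply', subst] at ih ⊢
    rw [ih, ← Function.iterate_succ_apply, Function.iterate_succ_apply']

theorem iterate_up_apply {z n y : ℕ} {σ : ℕ → Term} (hσ : ∀ k ≠ z, σ k = var k)
    (hy : y ≠ z + n) : up^[n] σ y = var y := by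
  induction n generalizing y with
  | zero => exact hσ y hy
  | succ n ih =>
    rw [Function.iterate_succ_apply']
    cases y with
    | zero => rfl
    | succ y =>
      simp only [up]
      rw [ih (by omega)]
      rfl

/-! ### Solvability -/

theorem Solvable.of_conv {M N : Term} (h : Conv M N) (hM : Solvable M) : Solvable N := by
  obtain ⟨σ, Ns, hM⟩ := hM
  exact ⟨σ, Ns, ((h.symm.subst σ).apps Ns).trans hM⟩

theorem Solvable.of_subst {M : Term} {σ : ℕ → Term} (h : Solvable (Term.subst σ M)) :
    Solvable M := by
  obtain ⟨τ, Ns, h⟩ := h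
  rw [subst_subst] at h
  exact ⟨_, Ns, h⟩

theorem Solvable.of_app {M N : Term} (h : Solvable (Term.app M N)) : Solvable M := by
  obtain ⟨σ, Ns, h⟩ := h
  exact ⟨σ, Term.subst σ N :: Ns, h⟩

theorem solvable_app_var (x : ℕ) (M : Term) : Solvable (app (var x) M) :=
  ⟨fun _ => lam I, [], .rel _ _ (Step.beta _ _)⟩

/-! ### Infinite stacks of a variable -/

/-- For all `d`, the term `P` is convertible to `x (x (⋯ (x M)))` with `d` copies of `x` and some
`M`, that is, the Böhm tree of `P` is `x (x (x ⋯))`. -/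
def IsStack (x : ℕ) (P : Term) : Prop := ∀ d : ℕ, ∃ M, Conv P ((app (var x))^[d] M)

theorem IsStack.of_conv {x : ℕ} {P Q : Term} (h : Conv P Q) (hP : IsStack x P) : IsStack x Q :=
  fun d => (hP d).imp fun _ hM => h.symm.trans hM

theorem IsStack.unfold {x : ℕ} {P : Term} (h : IsStack x P) :
    ∃ P', Conv P (app (var x) P') ∧ IsStack x P' := by
  obtain ⟨P', hP'⟩ := h 1
  refine ⟨P', hP', fun d => ?_⟩
  obtain ⟨M, hM⟩ := h (d + 1)
  rw [Function.iterate_succ_apply'] at hM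
  exact ⟨M, (hP'.symm.trans hM).app_var_inj⟩

theorem IsStack.app_var {x : ℕ} {P : Term} (h : IsStack x P) : IsStack x (app (var x) P) := by
  intro d
  obtain ⟨M, hM⟩ := h d
  refine ⟨app (var x) M, ?_⟩
  rw [← Function.iterate_succ_apply, Function.iterate_succ_apply']
  exact (Conv.refl _).app hM

theorem IsStack.subst {x : ℕ} {P : Term} (h : IsStack x P) {σ : ℕ → Term} {y : ℕ}
    (hσ : σ x = var y) : IsStack y (subst σ P) := by
  intro d
  obtain ⟨M, hM⟩ := h d
  refine ⟨Term.subst σ M, ?_⟩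
  have := hM.subst σ
  rwa [subst_iterate_app, Term.subst, hσ] at this

theorem IsStack.solvable {x : ℕ} {P : Term} (h : IsStack x P) : Solvable P := by
  obtain ⟨M, hM, -⟩ := h.unfold
  exact (solvable_app_var x M).of_conv hM.symm

theorem IsStack.bohmEq {x : ℕ} {P Q : Term} (hP : IsStack x P) (hQ : IsStack x Q) :
    BohmEq P Q := by
  refine ⟨fun P Q => IsStack x P ∧ IsStack x Q, fun P Q ⟨hP, hQ⟩ => Or.inr ?_, hP, hQ⟩
  obtain ⟨P', hP, hP'⟩ := hP.unfold
  obtain ⟨Q', hQ, hQ'⟩ := hQ.unfold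
  exact ⟨0, x, [P'], [Q'], hP, hQ, .cons ⟨hP', hQ'⟩ .nil⟩

/-- The relation `R` compares Böhm trees: related terms are both unsolvable, or they have head normal
forms of the same shape with related arguments. Terms with the same Böhm tree are those related by
some such `R`. -/
def IsBohmBisimulation (R : Term → Term → Prop) : Prop :=
  ∀ P Q, R P Q → (¬ Solvable P ∧ ¬ Solvable Q) ∨ ∃ (n y : ℕ) (Ps Qs : List Term),
    Conv P (lams n (apps (var y) Ps)) ∧ Conv Q (lams n (apps (var y) Qs)) ∧
      List.Forall₂ R Ps Qs

/-- A Böhm tree comparison of two terms that start with the same variable can be continued with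
their arguments. -/
theorem exists_rel_arg {R : Term → Term → Prop} (hR : IsBohmBisimulation R)
    {P Q : Term} (h : R P Q) {x : ℕ} {Q' : Term} (hQ : Conv Q (app (var x) Q')) :
    ∃ P₁ Q₁, Conv P (app (var x) P₁) ∧ Conv Q' Q₁ ∧ R P₁ Q₁ := by
  rcases hR P Q h with ⟨-, hns⟩ | ⟨n, y, Ps, Qs, hP, hQ', hPQ⟩
  · exact absurd ((solvable_app_var x Q').of_conv hQ.symm) hns
  · have hc : Conv (lams 0 (apps (var x) [Q'])) (lams n (apps (var y) Qs)) := hQ.symm.trans hQ'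
    obtain ⟨rfl, rfl, hargs⟩ := hc.lams_apps_inj
    cases hargs with
    | cons harg hnil =>
      cases hnil
      cases hPQ with
      | cons hrel hnil =>
        cases hnil
        exact ⟨_, _, hP, harg, hrel⟩

end Term

open Term

/-! ### Fixed point combinators -/

theorem app_var_conv_subst {Y M : Term} {x : ℕ} (hx : x ∉ FV Y)
    (h : Conv (app Y (var x)) M) (σ : ℕ → Term) (a : Term) :
    Conv (app (subst σ Y) a) (subst (Function.update σ x a) M) := by
  have := h.subst (Function.update σ x a)
  rwa [subst_update_app_var hx] at this

/-- A single fresh variable is enough to recognize a fixed point combinator. -/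
theorem mem_FPC_of_fresh {Y : Term} {x : ℕ} (hx : x ∉ FV Y)
    (h : Conv (app Y (var x)) (app (var x) (app Y (var x)))) : Y ∈ FPC := by
  intro y _
  have := app_var_conv_subst hx h var (var y)
  rwa [subst, subst_update_app_var hx, subst, Function.update_self, subst_var] at this

/-- A term `Y` is a weak fixed point combinator if `Y x` is an infinite stack of copies of `x` for
a single fresh `x`. -/
theorem mem_WFPC_of_fresh {Y : Term} {x : ℕ} (hx : x ∉ FV Y)
    (h : IsStack x (app Y (var x))) : Y ∈ WFPC := by
  intro y _
  have hY : IsStack y (app Y (var y)) := by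
    have := h.subst (σ := Function.update var x (var y)) (Function.update_self _ _ _)
    rwa [subst_update_app_var hx, subst_var] at this
  exact hY.bohmEq hY.app_var

theorem isStack_of_mem_WFPC {Y : Term} (hY : Y ∈ WFPC) {x : ℕ} (hx : x ∉ FV Y) :
    IsStack x (app Y (var x)) := by
  obtain ⟨R, hR, h⟩ := hY x hx
  -- A stack of height `d` on the right of a related pair is inherited by the left.
  have key : ∀ (d : ℕ) (P Q M : Term), R P Q → Conv Q ((app (var x))^[d] M) →
      ∃ M', Conv P ((app (var x))^[d] M') := by
    intro d
    induction d with
    | zero => exact fun P _ _ _ _ => ⟨P, .refl P⟩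
    | succ d ih =>
      intro P Q M hPQ hQ
      rw [Function.iterate_succ_apply'] at hQ
      obtain ⟨P₁, Q₁, hP, hQ₁, h₁⟩ := exists_rel_arg hR hPQ hQ
      obtain ⟨M', hM'⟩ := ih P₁ Q₁ M h₁ hQ₁.symm
      refine ⟨M', ?_⟩
      rw [Function.iterate_succ_apply']
      exact hP.trans ((Conv.refl _).app hM')
  intro d
  induction d with
  | zero => exact ⟨_, .refl _⟩
  | succ d ih =>
    obtain ⟨M, hM⟩ := ih
    refine key (d + 1) _ _ M h ?_
    rw [Function.iterate_succ_apply']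
    exact (Conv.refl _).app hM

theorem FPC_subset_WFPC : FPC ⊆ WFPC := by
  intro Y hY
  obtain ⟨x, hx⟩ := exists_fresh [Y]
  have hx : x ∉ FV Y := hx Y (by simp)
  refine mem_WFPC_of_fresh hx fun d => ⟨app Y (var x), ?_⟩
  induction d with
  | zero => exact .refl _
  | succ d ih =>
    rw [Function.iterate_succ_apply']
    exact (hY x hx).trans ((Conv.refl _).app ih)

theorem FPC_of_conv {Y Z : Term} (h : Conv Y Z) (hY : Y ∈ FPC) : Z ∈ FPC := by
  obtain ⟨x, hx⟩ := exists_fresh [Y, Z]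
  have hc := h.app (Conv.refl (var x))
  exact mem_FPC_of_fresh (hx Z (by simp))
    ((hc.symm.trans (hY x (hx Y (by simp)))).trans ((Conv.refl _).app hc))

theorem WFPC_of_conv {Y Z : Term} (h : Conv Y Z) (hY : Y ∈ WFPC) : Z ∈ WFPC := by
  obtain ⟨x, hx⟩ := exists_fresh [Y, Z]
  exact mem_WFPC_of_fresh (hx Z (by simp))
    ((isStack_of_mem_WFPC hY (hx Y (by simp))).of_conv (h.app (.refl _)))

theorem FPC_subst {Y : Term} (hY : Y ∈ FPC) (σ : ℕ → Term) : subst σ Y ∈ FPC := by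
  obtain ⟨x, hx⟩ := exists_fresh [Y]
  have hx : x ∉ FV Y := hx Y (by simp)
  intro y _
  have := app_var_conv_subst hx (hY x hx) σ (var y)
  rwa [subst, subst_update_app_var hx, subst, Function.update_self] at this

theorem WFPC_subst {Y : Term} (hY : Y ∈ WFPC) (σ : ℕ → Term) : subst σ Y ∈ WFPC := by
  obtain ⟨x, hx⟩ := exists_fresh [Y]
  obtain ⟨y, hy⟩ := exists_fresh [subst σ Y]
  have hx : x ∉ FV Y := hx Y (by simp)
  refine mem_WFPC_of_fresh (hy _ (by simp)) ?_
  have := (isStack_of_mem_WFPC hY hx).subst (σ := Function.update σ x (var y))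
    (Function.update_self _ _ _)
  rwa [subst_update_app_var hx] at this

/-- A weak fixed point combinator iterates its argument any number of times. -/
theorem WFPC_app_conv {Y : Term} (hY : Y ∈ WFPC) (F : Term) (k : ℕ) :
    ∃ M, Conv (app Y F) ((app F)^[k] M) := by
  obtain ⟨x, hx⟩ := exists_fresh [Y]
  have hx : x ∉ FV Y := hx Y (by simp)
  obtain ⟨M, hM⟩ := isStack_of_mem_WFPC hY hx k
  refine ⟨subst (Function.update var x F) M, ?_⟩
  have := app_var_conv_subst hx hM var F
  rwa [subst_var, subst_iterate_app, subst, Function.update_self] at this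

theorem Steps.of_app_var {P t : Term} {x : ℕ} (h : Steps (app P (var x)) t) :
    (∃ P', t = app P' (var x) ∧ Steps P P') ∨
      ∃ A, Steps P (lam A) ∧ Steps (subst (single (var x)) A) t := by
  induction h with
  | refl => exact Or.inl ⟨P, rfl, .refl⟩
  | tail _ h ih =>
    rcases ih with ⟨P', rfl, hP⟩ | ⟨A, hA, ht⟩
    · cases h with
      | beta t a => exact Or.inr ⟨t, hP, .refl⟩
      | appL _ h => exact Or.inl ⟨_, rfl, hP.tail h⟩
      | appR _ h => cases h
    · exact Or.inr ⟨A, hA, ht.tail h⟩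

/-- Weak fixed point combinators have the head normal form `λ f. f A`, where the Böhm tree of `A`
is `f (f (f ⋯))`. -/
theorem WFPC_hnf {Y : Term} (hY : Y ∈ WFPC) :
    ∃ A, Conv Y (lam (app (var 0) A)) ∧ IsStack 0 A := by
  obtain ⟨x, hx⟩ := exists_fresh [Y]
  have hx : x ∉ FV Y := hx Y (by simp)
  have hs := isStack_of_mem_WFPC hY hx
  obtain ⟨M, hM, -⟩ := hs.unfold
  obtain ⟨r, hr, hMr⟩ := hM.exists_steps
  obtain ⟨Rs, rfl, hRs⟩ := Steps.of_lams_apps (n := 0) (y := x) (Ps := [M]) hMr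
  rcases Steps.of_app_var hr with ⟨P', he, hP⟩ | ⟨B, hB, -⟩
  · cases hRs with
    | cons _ hnil =>
      cases hnil
      have he : var x = P' := (app.inj he).1
      subst he
      exact absurd (hP.FV_subset rfl) hx
  · have hB0 : IsStack 0 B := by
      have h₁ : IsStack x (subst (single (var x)) B) :=
        hs.of_conv ((hB.conv.app (.refl _)).trans (.rel _ _ (.beta _ _)))
      have h₂ := h₁.subst (σ := Function.update (fun n => var (n + 1)) x (var 0))
        (Function.update_self _ _ _)
      rw [subst_subst] at h₂
      have e : ∀ n ∈ FV B, subst (Function.update (fun n => var (n + 1)) x (var 0))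
          (single (var x) n) = var n := by
        rintro (_ | n) hn
        · exact Function.update_self _ _ _
        · refine Function.update_of_ne ?_ _ _
          rintro rfl
          exact hx (hB.FV_subset hn)
      rwa [subst_congr e, subst_var] at h₂
    obtain ⟨A, hA, hA0⟩ := hB0.unfold
    exact ⟨A, hB.conv.trans hA.lam, hA0⟩

theorem WFPC_bohmEq {Y Z : Term} (hY : Y ∈ WFPC) (hZ : Z ∈ WFPC) : BohmEq Y Z := by
  refine ⟨fun P Q => (P ∈ WFPC ∧ Q ∈ WFPC) ∨ IsStack 0 P ∧ IsStack 0 Q, ?_, Or.inl ⟨hY, hZ⟩⟩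
  rintro P Q (⟨hP, hQ⟩ | ⟨hP, hQ⟩)
  · obtain ⟨A, hA, hA0⟩ := WFPC_hnf hP
    obtain ⟨B, hB, hB0⟩ := WFPC_hnf hQ
    exact Or.inr ⟨1, 0, [A], [B], hA, hB, .cons (Or.inr ⟨hA0, hB0⟩) .nil⟩
  · obtain ⟨A, hA, hA0⟩ := hP.unfold
    obtain ⟨B, hB, hB0⟩ := hQ.unfold
    exact Or.inr ⟨0, 0, [A], [B], hA, hB, .cons (Or.inr ⟨hA0, hB0⟩) .nil⟩

/-! ### Complete developments and substitution -/

namespace Term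

theorem isLam_rename {ρ : ℕ → ℕ} {t : Term} : IsLam (rename ρ t) ↔ IsLam t := by
  cases t <;> exact Iff.rfl

theorem not_isLam_subst {σ : ℕ → Term} (hσ : ∀ n, ¬ IsLam (σ n)) {t : Term} (ht : ¬ IsLam t) :
    ¬ IsLam (subst σ t) := by
  cases t with
  | var n => exact hσ n
  | app _ _ => exact id
  | lam _ => exact absurd trivial ht

theorem dev_rename (ρ : ℕ → ℕ) (t : Term) : dev (rename ρ t) = rename ρ (dev t) := by
  induction t generalizing ρ with
  | var n => rfl
  | lam t ih => exact congrArg lam (ih _)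
  | app s t ihs iht =>
    by_cases hs : IsLam s
    · cases s with
      | lam u =>
        have hu := lam.inj (ihs ρ)
        simp only [rename, dev]
        rw [hu, iht, rename_subst_single]
      | var n => exact hs.elim
      | app _ _ => exact hs.elim
    · rw [rename, dev_app (mt isLam_rename.1 hs), dev_app hs, ihs, iht, rename]

/-- Complete development commutes with a substitution that creates no redexes. -/
theorem dev_subst {σ : ℕ → Term} (hσ : ∀ n, ¬ IsLam (σ n)) (t : Term) :
    dev (subst σ t) = subst (fun n => dev (σ n)) (dev t) := by
  induction t generalizing σ with
  | var n => rfl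
  | lam t ih =>
    have hup : ∀ n, ¬ IsLam (up σ n) := by
      rintro (_ | n)
      · exact id
      · exact mt isLam_rename.1 (hσ n)
    have e : (fun n => dev (up σ n)) = up fun n => dev (σ n) := by
      funext n
      cases n with
      | zero => rfl
      | succ n => exact dev_rename _ _
    simp only [subst, dev]
    rw [ih hup, e]
  | app s t ihs iht =>
    by_cases hs : IsLam s
    · cases s with
      | lam u =>
        have hu := lam.inj (ihs hσ)
        simp only [subst, dev]
        rw [hu, iht hσ, subst_up_subst_single]
      | var n => exact hs.elim
      | app _ _ => exact hs.elim
    · rw [subst, dev_app (not_isLam_subst hσ hs), dev_app hs, ihs hσ, iht hσ, subst]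

theorem dev_subst_update {v : ℕ} {a : Term} (ha : ¬ IsLam a) (t : Term) :
    dev (subst (Function.update var v a) t) = subst (Function.update var v (dev a)) (dev t) := by
  rw [dev_subst]
  · congr 1
    funext n
    by_cases hn : n = v
    · subst hn; simp
    · simp [hn, dev]
  · intro n
    by_cases hn : n = v
    · subst hn; simpa using ha
    · simp [hn, IsLam]

end Term

/-! ### A fixed point combinator with a passive variable -/

/-- The term `w = λ f p x. f (x f p x)`, so that `w F p w` reduces to `F (w F p w)`. -/
def loopBody : Term :=
  lam (lam (lam (app (var 2) (app (app (app (var 0) (var 2)) (var 1)) (var 0)))))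

/-- The term `w F z w`, which reduces to `F (w F z w)` and always keeps the variable `z`. -/
def loop (z : ℕ) (F : Term) : Term := app (app (app loopBody F) (var z)) loopBody

/-- The fixed point combinator `λ f. w f z w`, in which `z` occurs passively. -/
def genFPC (z : ℕ) : Term := lam (loop (z + 1) (var 0))

theorem subst_loop {σ : ℕ → Term} {z z' : ℕ} (hσ : σ z = var z') (F : Term) :
    subst σ (loop z F) = loop z' (subst σ F) := by
  simp [loop, subst, loopBody, up, rename, hσ]

theorem mem_FV_loop (z : ℕ) (F : Term) : z ∈ FV (loop z F) := by simp [loop, FV]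

theorem loop_conv (z : ℕ) (F : Term) : Conv (loop z F) (app F (loop z F)) := by
  have h : Conv (loop z F) _ := Steps.conv <|
    ((Relation.ReflTransGen.single (.appL _ (.appL _ (.beta _ _)))).tail
      (.appL _ (.beta _ _))).tail (.beta _ _)
  simpa [subst, up, single, rename, subst_up_rename, subst_single_rename, loop] using h

theorem app_genFPC_conv (z : ℕ) (F : Term) : Conv (app (genFPC z) F) (loop z F) := by
  have h : Conv (app (genFPC z) F) _ := .rel _ _ (.beta _ _)
  rwa [subst_loop (σ := single F) (z' := z) rfl] at h

theorem genFPC_mem (z : ℕ) : genFPC z ∈ FPC := fun x _ =>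
  (app_genFPC_conv z (var x)).trans ((loop_conv z _).trans
    ((Conv.refl _).app (app_genFPC_conv z (var x)).symm))

/-- Three complete developments unfold a loop once. -/
theorem dev_dev_dev_loop {v : ℕ} (z : ℕ) {F : Term} (hv : v ∉ FV F) :
    dev (dev (dev (loop z F))) =
      subst (Function.update var v (loop z (dev (dev (dev F)))))
        (dev (dev (app (dev F) (var v)))) := by
  set G := dev F with hG
  have hvG : v ∉ FV G := fun h => hv ((steps_dev F).FV_subset h)
  -- The first two abstractions of `w` shift the variables of `G`, and `v` marks the argument.
  let τ (k : ℕ) (a : Term) : ℕ → Term := Function.update (fun n => var (n + k)) v a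
  let s : Term → Term := rename Nat.succ
  have hτ : ∀ (k : ℕ) (a : Term), ¬ IsLam a → ∀ t,
      dev (subst (τ k a) t) = subst (τ k (dev a)) (dev t) := by
    intro k a ha t
    rw [dev_subst]
    · congr 1
      funext n
      by_cases hn : n = v
      · subst hn; simp [τ]
      · simp [hn, dev, τ]
    · intro n
      by_cases hn : n = v
      · subst hn; simpa [τ] using ha
      · simp [hn, IsLam, τ]
  have h₁ : dev (loop z F) = app (app (lam (lam (subst (τ 2 (app (app (app (var 0) (s (s G)))
      (var 1)) (var 0))) (app G (var v))))) (var z)) loopBody := by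
    have e : subst (τ 2 (app (app (app (var 0) (s (s G))) (var 1)) (var 0))) G = s (s G) := by
      rw [subst_update_of_notMem hvG]
      simp only [s, rename_rename]
      exact (rename_eq_subst _ _).symm
    simp only [subst, e]
    simp [loop, loopBody, dev, subst, up, single, τ, s, ← hG, rename]
  have h₂ : dev (dev (loop z F)) = app (lam (subst (τ 1 (app (app (app (var 0) (s (dev G)))
      (var (z + 1))) (var 0))) (dev (app G (var v))))) loopBody := by
    rw [h₁, dev_app (by exact id), dev, dev, dev, hτ _ _ (by exact id)]
    simp only [subst, subst_subst]
    congr 3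
    funext n
    by_cases hn : n = v
    · subst hn
      simp [τ, s, dev, dev_rename, subst, up, single, rename, subst_up_rename,
        subst_single_rename]
    · simp [τ, hn, subst, up, single, rename, dev]
  have h₃ : dev (dev (dev (loop z F))) = subst (τ 0 (loop z (dev (dev G))))
      (dev (dev (app G (var v)))) := by
    rw [h₂, dev, hτ _ _ (by exact id), subst_subst]
    congr 1
    funext n
    by_cases hn : n = v
    · subst hn
      simp [τ, s, loop, loopBody, dev, dev_rename, subst, single, subst_single_rename]
    · simp [τ, hn, subst, single]
  exact h₃

/-- Each block of three developments replaces the hole `v` by a reduct of `F v` around a new loop,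
so that `m` blocks reduce `C[Fᵐ(v)]` and leave a loop in the hole. -/
theorem dev_iterate_loop {z v : ℕ} (m : ℕ) (C : Term) {F : Term} (hv : v ∉ FV F) :
    ∃ C' F', dev^[3 * m] (subst (Function.update var v (loop z F)) C) =
        subst (Function.update var v (loop z F')) C' ∧
      Steps (subst (Function.update var v ((app F)^[m] (var v))) C) C' := by
  induction m generalizing C F with
  | zero => exact ⟨C, F, rfl, by simp [subst_var, Relation.ReflTransGen.refl]⟩
  | succ m ih =>
    set F' := dev (dev (dev F)) with hF'
    have hFF' : Steps F F' := steps_iterate_dev F 3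
    set D := dev (dev (app (dev F) (var v))) with hD
    have hFD : Steps (app F (var v)) D :=
      ((steps_dev F).appL _).trans (steps_iterate_dev (app (dev F) (var v)) 2)
    set C₁ := subst (Function.update var v D) (dev (dev (dev C))) with hC₁
    have hstep : dev (dev (dev (subst (Function.update var v (loop z F)) C))) =
        subst (Function.update var v (loop z F')) C₁ := by
      rw [dev_subst_update (by exact id), dev_subst_update (by exact id),
        dev_subst_update (by exact id), dev_dev_dev_loop z hv, hC₁, subst_update_subst_update]
    have hC : Steps (subst (Function.update var v (app F (var v))) C) C₁ :=
      ((steps_iterate_dev C 3).subst _).trans (hFD.subst_update v _)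
    obtain ⟨C', F'', h₁, h₂⟩ := ih C₁ (fun h => hv (hFF'.FV_subset h))
    refine ⟨C', F'', ?_, ?_⟩
    · rw [Nat.mul_succ, Function.iterate_add_apply]
      exact (congrArg _ hstep).trans h₁
    · have hit : subst (Function.update var v ((app F)^[m + 1] (var v))) C =
          subst (Function.update var v ((app F)^[m] (var v)))
            (subst (Function.update var v (app F (var v))) C) := by
        rw [subst_update_subst_update, subst_update_app_var hv, subst_var,
          Function.iterate_succ_apply']
      rw [hit]
      exact ((hC.subst _).trans ((hFF'.iterate_app _ m).subst_update v _)).trans h₂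

/-- Reduction of a term `C[w F z w]` is, up to further reduction, reduction of `C[Fᵐ(v)]` for some
`m`, in which the loop takes no part. -/
theorem exists_approx {z v : ℕ} {C F N : Term} (hv : v ∉ FV F)
    (h : Steps (subst (Function.update var v (loop z F)) C) N) :
    ∃ m C' F', Steps (subst (Function.update var v ((app F)^[m] (var v))) C) C' ∧
      Steps N (subst (Function.update var v (loop z F')) C') := by
  obtain ⟨m, hm⟩ := h.exists_iterate_dev
  obtain ⟨C', F', h₁, h₂⟩ := dev_iterate_loop (z := z) m C hv
  exact ⟨m, C', F', h₂, h₁ ▸ hm (3 * m) (by omega)⟩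

/-! ### Truncated unfoldings of generators -/

/-- The term `G₀ᵏ(M) G₁ ⋯ Gₙ`, to which `Y G₀ G₁ ⋯ Gₙ` unfolds when `Y` is a fixed point
combinator. -/
def unfolding (G₀ : Term) (k : ℕ) (M : Term) (Gs : List Term) : Term :=
  apps ((app G₀)^[k] M) Gs

theorem subst_unfolding {σ : ℕ → Term} {G₀ : Term} {Gs : List Term}
    (h : ∀ A ∈ G₀ :: Gs, subst σ A = A) (k : ℕ) (M : Term) :
    subst σ (unfolding G₀ k M Gs) = unfolding G₀ k (subst σ M) Gs := by
  rw [unfolding, subst_apps, subst_iterate_app, h G₀ (by simp), unfolding]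
  congr 1
  exact List.map_congr_left (g := id) (fun A hA => h A (by simp [hA])) |>.trans (List.map_id _)

theorem subst_update_unfolding {v : ℕ} {G₀ : Term} {Gs : List Term}
    (h : ∀ A ∈ G₀ :: Gs, v ∉ FV A) (k : ℕ) (M : Term) :
    subst (Function.update var v M) (unfolding G₀ k (var v) Gs) = unfolding G₀ k M Gs := by
  rw [subst_unfolding fun A hA => subst_update_var_of_notMem (h A hA) M, subst,
    Function.update_self]

theorem mem_FV_unfolding {n k : ℕ} {G₀ M : Term} {Gs : List Term}
    (h : n ∈ FV (unfolding G₀ k M Gs)) : n ∈ FV M ∨ ∃ A ∈ G₀ :: Gs, n ∈ FV A := by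
  rcases mem_FV_apps.1 h with h | ⟨A, hA, h⟩
  · have hit : ∀ k, n ∈ FV ((app G₀)^[k] M) → n ∈ FV G₀ ∨ n ∈ FV M := by
      intro k
      induction k with
      | zero => exact Or.inr
      | succ k ih =>
        rw [Function.iterate_succ_apply']
        rintro (h | h)
        · exact Or.inl h
        · exact ih h
    rcases hit k h with h | h
    · exact Or.inr ⟨G₀, by simp, h⟩
    · exact Or.inl h
  · exact Or.inr ⟨A, by simp [hA], h⟩

theorem act_conv {Y Z : Term} (h : Conv Y Z) (G : Vec) : Conv (act Y G) (act Z G) := h.apps _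

theorem act_conv_unfolding {Y : Term} (hY : Y ∈ WFPC) {G : Vec} {G₀ : Term} {Gs : List Term}
    (hG : G.toList = G₀ :: Gs) (k : ℕ) : ∃ M, Conv (act Y G) (unfolding G₀ k M Gs) := by
  obtain ⟨M, hM⟩ := WFPC_app_conv hY G₀ k
  refine ⟨M, ?_⟩
  rw [act, hG]
  exact hM.apps Gs

theorem act_genFPC_conv (z : ℕ) {G : Vec} {G₀ : Term} {Gs : List Term}
    (hG : G.toList = G₀ :: Gs) : Conv (act (genFPC z) G) (apps (loop z G₀) Gs) := by
  rw [act, hG]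
  exact (app_genFPC_conv z G₀).apps Gs

theorem subst_update_apps_var {v : ℕ} {Gs : List Term} (h : ∀ A ∈ Gs, v ∉ FV A) (M : Term) :
    subst (Function.update var v M) (apps (var v) Gs) = apps M Gs :=
  subst_update_unfolding (G₀ := I) (Gs := Gs)
    (by simpa [I, FV] using h) 0 M

/-! ### Constant generators -/

theorem IsConstant.exists_value {G : Vec} (hG : IsConstant G) :
    ∃ N, ∀ Y ∈ WFPC, Conv (act Y G) N := by
  obtain ⟨G₀, Gs, hGs, k, h⟩ := hG
  obtain ⟨z, hz⟩ := exists_fresh G.toList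
  obtain ⟨N, hN, hzN⟩ := h z hz
  refine ⟨N, fun Y hY => ?_⟩
  obtain ⟨M, hM⟩ := act_conv_unfolding hY hGs k
  have hs := hN.symm.subst (Function.update var z M)
  rw [subst_update_var_of_notMem hzN] at hs
  rw [hGs] at hz
  exact hM.trans ((subst_update_unfolding hz k M) ▸ hs)

/-- If the passive variable `z` disappears from the value of a nonempty vector `H` at the
combinator `genFPC z`, then `H` is constant: the reduction that erases `z` also erases `z` when
the loop is replaced by a sufficiently long unfolding. -/
theorem isConstant_of_genFPC {H : Vec} (hH : H.toList ≠ []) {z : ℕ} {N : Term} (hz : z ∉ FV N)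
    (h : Conv (act (genFPC z) H) N) : IsConstant H := by
  obtain ⟨H₀, Hs, hHs⟩ := List.exists_cons_of_ne_nil hH
  obtain ⟨v, hv⟩ := exists_fresh (H₀ :: Hs)
  obtain ⟨r, hr, hNr⟩ := ((act_genFPC_conv z hHs).symm.trans h).exists_steps
  have hvs : ∀ A ∈ Hs, v ∉ FV A := fun A hA => hv A (by simp [hA])
  rw [← subst_update_apps_var hvs] at hr
  obtain ⟨m, C', F', hC, hrC⟩ := exists_approx (hv H₀ (by simp)) hr
  have hvC : v ∉ FV C' := by
    intro hvC
    refine hz (hNr.FV_subset (hrC.FV_subset (mem_FV_subst.2 ⟨v, hvC, ?_⟩)))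
    rw [Function.update_self]
    exact mem_FV_loop z F'
  rw [subst_update_apps_var hvs] at hC
  refine ⟨H₀, Hs, hHs, m, fun y hy => ⟨C', ?_, ?_⟩⟩
  · have hs := hC.subst (Function.update var v (var y))
    rw [subst_update_var_of_notMem hvC] at hs
    have e := subst_update_unfolding hv m (var y)
    rw [unfolding] at e
    rw [e] at hs
    exact hs.conv.symm
  · intro hyC
    rcases mem_FV_unfolding (hC.FV_subset hyC) with h | ⟨A, hA, h⟩
    · exact hvC ((show y = v from h) ▸ hyC)
    · exact hy A (hHs ▸ hA) h

theorem isConstant_iff {G : Vec} :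
    IsConstant G ↔ G.toList ≠ [] ∧ ∃ N, ∀ Y ∈ FPC, Conv (act Y G) N := by
  constructor
  · intro h
    obtain ⟨N, hN⟩ := h.exists_value
    obtain ⟨G₀, Gs, hGs, -⟩ := h
    exact ⟨by simp [hGs], N, fun Y hY => hN Y (FPC_subset_WFPC hY)⟩
  · rintro ⟨hne, N, hN⟩
    obtain ⟨z, hz⟩ := exists_fresh [N]
    exact isConstant_of_genFPC hne (hz N (by simp)) (hN _ (genFPC_mem z))

theorem iterate_app_var_normal {x z k : ℕ} {t : Term} :
    ¬ Step ((app (var x))^[k] (var z)) t := by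
  induction k generalizing t with
  | zero => intro h; cases h
  | succ k ih =>
    rw [Function.iterate_succ_apply']
    intro h
    cases h with
    | appL _ h => cases h
    | appR _ h => exact ih h

/-- Fixed point combinators are not all convertible: otherwise the vector consisting of a variable
`x` would be constant, and `x (⋯ (x z))` is a normal form that contains `z`. -/
theorem not_FPC_subsingleton : ¬ ∃ N, ∀ Y ∈ FPC, Conv Y N := by
  rintro ⟨N, hN⟩
  have hc : IsConstant (FreeMonoid.of (var 0)) :=
    isConstant_iff.2 ⟨by simp, act N (FreeMonoid.of (var 0)), fun Y hY => act_conv (hN Y hY) _⟩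
  obtain ⟨G₀, Gs, hGs, k, h⟩ := hc
  rw [FreeMonoid.toList_of, List.cons.injEq] at hGs
  obtain ⟨rfl, rfl⟩ := hGs
  obtain ⟨M, hM, h1M⟩ := h 1 (by simp [FV])
  obtain ⟨r, hr, hr'⟩ := hM.exists_steps
  have e : r = (app (var 0))^[k] (var 1) := by
    rcases hr'.cases_head with h | ⟨t, h, -⟩
    · exact h.symm
    · exact absurd h iterate_app_var_normal
  subst e
  refine h1M (hr.FV_subset ?_)
  clear hr hr' hM h h1M
  induction k with
  | zero => rfl
  | succ k ih =>
    rw [Function.iterate_succ_apply']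
    exact Or.inr ih

/-- The constant generator `λ y. Y`, with `Y` a fixed point combinator. -/
def constGen : Vec := FreeMonoid.of (lam (rename Nat.succ (genFPC 0)))

theorem act_constGen {Y : Term} (hY : Y ∈ WFPC) : Conv (act Y constGen) (genFPC 0) := by
  obtain ⟨M, hM⟩ := act_conv_unfolding hY (FreeMonoid.toList_of _) 1
  refine Conv.trans hM (.rel _ _ ?_)
  have h := Step.beta (rename Nat.succ (genFPC 0)) M
  rwa [subst_single_rename] at h

theorem isConstant_constGen : IsConstant constGen :=
  isConstant_iff.2 ⟨by simp [constGen], _, fun _ hY => act_constGen (FPC_subset_WFPC hY)⟩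

/-- The argument is the same for the two monoids: all that matters is that generators turn fixed
point combinators into weak ones, on all of which a constant generator takes the same value. -/
theorem isMinimalIdeal_isConstant {M : Submonoid Vec}
    (hM : ∀ G ∈ M, ∀ Y ∈ FPC, act Y G ∈ WFPC) (hc : constGen ∈ M) :
    IsMinimalIdeal M {G | G ∈ M ∧ IsConstant G} := by
  refine ⟨⟨fun G hG => hG.1, ?_⟩, ⟨constGen, hc, isConstant_constGen⟩, ?_, ?_⟩
  · rintro G ⟨hGM, hG⟩ H hH
    obtain ⟨N, hN⟩ := hG.exists_value
    have hne := (isConstant_iff.1 hG).1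
    refine ⟨⟨M.mul_mem hGM hH, isConstant_iff.2 ⟨by simp_all, act N H, fun Y hY => ?_⟩⟩,
      ⟨M.mul_mem hH hGM, isConstant_iff.2 ⟨by simp_all, N, fun Y hY => ?_⟩⟩⟩
    · rw [act_mul]
      exact act_conv (hN Y (FPC_subset_WFPC hY)) H
    · rw [act_mul]
      exact hN _ (hM H hH Y hY)
  · rintro G ⟨-, hG⟩ H hH hGH
    obtain ⟨-, N, hN⟩ := isConstant_iff.1 hG
    have hHN : ∀ Y ∈ FPC, Conv (act Y H) N := fun Y hY => (hGH Y hY).symm.trans (hN Y hY)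
    refine ⟨hH, isConstant_iff.2 ⟨fun hnil => ?_, N, hHN⟩⟩
    refine not_FPC_subsingleton ⟨N, fun Y hY => ?_⟩
    have h := hHN Y hY
    rwa [act, hnil] at h
  · rintro J ⟨hJM, hJ⟩ ⟨H, hH⟩ G ⟨hGM, hG⟩
    obtain ⟨N, hN⟩ := hG.exists_value
    refine ⟨H * G, (hJ H hH G hGM).1, fun Y hY => ?_⟩
    rw [act_mul]
    exact (hN _ (hM H (hJM hH) Y hY)).trans (hN Y (FPC_subset_WFPC hY)).symm

/-! ### Weakly constant and weakly compact generators -/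

/-- Let `P` and `Q` be related by a Böhm tree comparison `R`, let `z` be absent from `Q`, and let a
substitution for `z` turn `P` into a head normal form `λ⋯. x B`. As the head variable of `P` is
that of `Q`, it is not `z`, so that `P` itself has this shape. -/
theorem exists_arg_of_subst {R : Term → Term → Prop} (hR : IsBohmBisimulation R)
    {P Q : Term} (hQP : R Q P) {z : ℕ} (hz : NotIn z Q) (hP : Solvable P) {σ : ℕ → Term}
    (hσ : ∀ k ≠ z, σ k = var k) {m x : ℕ} {B : Term}
    (hB : Conv (subst σ P) (lams m (apps (var x) [B]))) :
    ∃ P₁ Q₁, Conv P (lams m (apps (var x) [P₁])) ∧ R Q₁ P₁ ∧ NotIn (z + m) Q₁ ∧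
      Conv (subst (up^[m] σ) P₁) B := by
  rcases hR Q P hQP with ⟨-, h⟩ | ⟨n, y, Qs, Ps, hQ, hPs, hrel⟩
  · exact absurd hP h
  obtain ⟨N, hN, hzN⟩ := hz
  obtain ⟨r, hNr, hr⟩ := (hN.trans hQ).exists_steps
  obtain ⟨Rs, rfl, hRs⟩ := hr.of_lams_apps
  have hzr : z + n ∉ FV (apps (var y) Rs) := fun h => hzN (hNr.FV_subset (mem_FV_lams.2 h))
  rw [mem_FV_apps] at hzr
  have hy : y ≠ z + n := fun e => hzr (Or.inl e.symm)
  have hc := hB.symm.trans (hPs.subst σ)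
  rw [subst_lams, subst_apps, subst, iterate_up_apply hσ hy] at hc
  obtain ⟨rfl, rfl, hargs⟩ := hc.lams_apps_inj
  obtain ⟨P₁, Ps', hP₁, hnil, he⟩ := List.forall₂_cons_left_iff.1 hargs
  cases hnil
  rw [List.map_eq_singleton_iff] at he
  obtain ⟨P₁, rfl, rfl⟩ := he
  cases hrel with
  | @cons Q₁ _ _ _ h hnil =>
    cases hnil
    cases hRs with
    | @cons _ R₁ _ _ hR₁ hnil =>
      cases hnil
      exact ⟨P₁, Q₁, hPs, h, ⟨R₁, hR₁.conv.symm, fun h => hzr (Or.inr ⟨R₁, by simp, h⟩)⟩,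
        hP₁.symm⟩

theorem isStack_of_subst {R : Term → Term → Prop} (hR : IsBohmBisimulation R)
    {P Q : Term} (hQP : R Q P) {z x : ℕ} (hz : NotIn z Q) {σ : ℕ → Term}
    (hσ : ∀ k ≠ z, σ k = var k) (h : IsStack x (subst σ P)) : IsStack x P := by
  intro d
  induction d generalizing P Q with
  | zero => exact ⟨P, .refl P⟩
  | succ d ih =>
    obtain ⟨B, hB, hBx⟩ := h.unfold
    obtain ⟨P₁, Q₁, hP, h₁, hz₁, hc⟩ :=
      exists_arg_of_subst hR hQP hz h.solvable.of_subst hσ (m := 0) hB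
    obtain ⟨M, hM⟩ := ih h₁ hz₁ (hBx.of_conv hc.symm)
    refine ⟨M, ?_⟩
    rw [Function.iterate_succ_apply']
    exact hP.trans ((Conv.refl _).app hM)

/-- If the Böhm tree of `T` does not contain `z`, and a substitution instance `T[z := a]` is a weak
fixed point combinator, then so is `T`. -/
theorem mem_WFPC_of_subst {T a : Term} {z : ℕ} (hz : NotInInf z T)
    (h : subst (Function.update var z a) T ∈ WFPC) : T ∈ WFPC := by
  obtain ⟨N, ⟨R, hR, hNT⟩, hzN⟩ := hz
  have hσ : ∀ k ≠ z, Function.update var z a k = var k := fun k hk =>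
    Function.update_of_ne hk _ _
  obtain ⟨y, hy⟩ := exists_fresh [subst (Function.update var z a) T]
  have hsolv : Solvable T :=
    (isStack_of_mem_WFPC h (hy _ (by simp))).solvable.of_app.of_subst
  obtain ⟨A, hA, hA0⟩ := WFPC_hnf h
  obtain ⟨P, Q, hT, hQP, hzQ, hc⟩ :=
    exists_arg_of_subst hR hNT ⟨N, .refl N, hzN⟩ hsolv hσ (m := 1) hA
  have hP : IsStack 0 P := isStack_of_subst hR hQP hzQ
    (fun k hk => iterate_up_apply hσ hk) (hA0.of_conv hc.symm)
  obtain ⟨x, hx⟩ := exists_fresh [T]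
  refine mem_WFPC_of_fresh (hx T (by simp)) ?_
  have hx' : IsStack x (subst (single (var x)) (app (var 0) P)) :=
    hP.app_var.subst rfl
  exact hx'.of_conv ((hT.app (.refl _)).trans (.rel _ _ (.beta _ _))).symm

/-- The same truncation works on both sides. It has an instance without `z`, and an instance that is
convertible to a value of `G`. -/
theorem isWeaklyConstant_iff {G : Vec} (hG : G ∈ wfgv) :
    IsWeaklyConstant G ↔ IsWeaklyCompactGen G := by
  constructor
  · rintro ⟨G₀, Gs, hGs, k, h⟩
    refine ⟨G₀, Gs, hGs, k, fun z hz => ?_⟩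
    have hY := FPC_subset_WFPC (genFPC_mem 0)
    obtain ⟨M, hM⟩ := act_conv_unfolding hY hGs k
    refine mem_WFPC_of_subst (a := M) (h z hz) ?_
    rw [hGs] at hz
    have e := subst_update_unfolding hz k M
    rw [unfolding] at e
    rw [e]
    exact WFPC_of_conv hM (hG _ hY)
  · rintro ⟨G₀, Gs, hGs, k, h⟩
    refine ⟨G₀, Gs, hGs, k, fun z hz => ⟨unfolding G₀ k I Gs, ?_, ?_⟩⟩
    · refine WFPC_bohmEq ?_ (h z hz)
      have hs := WFPC_subst (h z hz) (Function.update var z I)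
      rw [hGs] at hz
      exact (subst_update_unfolding hz k I) ▸ hs
    · intro hzI
      rcases mem_FV_unfolding hzI with h | ⟨A, hA, h⟩
      · simp [I, FV] at h
      · exact hz A (hGs ▸ hA) h

/-! ### Products with compact generators -/

/-- If some truncation of `G` lies in `S`, then so do the values of `G` at weak fixed point
combinators, which are convertible to instances of that truncation. -/
theorem truncation_act {S : Set Term} (hconv : ∀ {P Q}, Conv P Q → P ∈ S → Q ∈ S)
    (hsubst : ∀ {P}, P ∈ S → ∀ σ, subst σ P ∈ S) {G : Vec} (hG : Truncation (fun _ M => M ∈ S) G)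
    {Y : Term} (hY : Y ∈ WFPC) : act Y G ∈ S := by
  obtain ⟨G₀, Gs, hGs, k, h⟩ := hG
  obtain ⟨z, hz⟩ := exists_fresh G.toList
  obtain ⟨M, hM⟩ := act_conv_unfolding hY hGs k
  have hs := hsubst (h z hz) (Function.update var z M)
  rw [hGs] at hz
  exact hconv hM.symm ((subst_update_unfolding hz k M) ▸ hs)

theorem truncation_mul_right {S : Set Term} {G L : Vec}
    (hG : Truncation (fun _ M => M ∈ S) G) (hL : ∀ Y ∈ S, act Y L ∈ S) :
    Truncation (fun _ M => M ∈ S) (G * L) := by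
  obtain ⟨G₀, Gs, hGs, k, h⟩ := hG
  refine ⟨G₀, Gs ++ L.toList, by simp [FreeMonoid.toList_mul, hGs], k, fun z hz => ?_⟩
  have := hL _ (h z fun A hA => hz A (by simp [FreeMonoid.toList_mul, hA]))
  rwa [act, apps, apps, ← List.foldl_append] at this

theorem steps_iterate_app_var {x k : ℕ} {M t : Term} (h : Steps ((app (var x))^[k] M) t) :
    ∃ M', t = (app (var x))^[k] M' := by
  induction k generalizing t with
  | zero => exact ⟨t, rfl⟩
  | succ k ih =>
    rw [Function.iterate_succ_apply'] at h
    obtain ⟨Qs, rfl, hQ⟩ := Steps.of_lams_apps (n := 0) (y := x) (Ps := [_]) h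
    cases hQ with
    | cons harg hnil =>
      cases hnil
      obtain ⟨M', rfl⟩ := ih harg
      exact ⟨M', by rw [Function.iterate_succ_apply']; rfl⟩

/-- A loop does not contribute to a stack of variables. -/
theorem eq_iterate_of_subst_loop {v z x k : ℕ} {F C M : Term}
    (h : subst (Function.update var v (loop z F)) C = (app (var x))^[k] M) :
    ∃ M', C = (app (var x))^[k] M' := by
  have hvar : ∀ n, Function.update var v (loop z F) n = loop z F ∨
      Function.update var v (loop z F) n = var n := by
    intro n
    by_cases hn : n = v
    · subst hn; simp
    · simp [hn]
  induction k generalizing C with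
  | zero => exact ⟨C, rfl⟩
  | succ k ih =>
    rw [Function.iterate_succ_apply'] at h
    cases C with
    | var n =>
      rw [subst] at h
      rcases hvar n with e | e <;> rw [e] at h <;> simp [loop] at h
    | lam t => simp [subst] at h
    | app s t =>
      simp only [subst, app.injEq] at h
      obtain ⟨hs, ht⟩ := h
      obtain ⟨M', rfl⟩ := ih ht
      refine ⟨M', ?_⟩
      rw [Function.iterate_succ_apply']
      cases s with
      | var n =>
        rw [subst] at hs
        rcases hvar n with e | e <;> rw [e] at hs
        · simp [loop] at hs
        · rw [hs]
      | app _ _ => simp [subst] at hs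
      | lam _ => simp [subst] at hs

/-- For a generator `L`, a sufficiently long truncation `L₀ʲ(A) L₁ ⋯ Lₘ` applied to `F` produces `k`
copies of `F`, just as the value of `L` at a fixed point combinator does. -/
theorem exists_unfolding_conv {L : Vec} {L₀ : Term} {Ls : List Term} (hLs : L.toList = L₀ :: Ls)
    {z : ℕ} (hL : act (genFPC z) L ∈ WFPC) (k : ℕ) :
    ∃ j, ∀ A F, ∃ M, Conv (app (unfolding L₀ j A Ls) F) ((app F)^[k] M) := by
  obtain ⟨v, hv⟩ := exists_fresh (L₀ :: Ls)
  obtain ⟨x, hx⟩ := exists_fresh (var v :: act (genFPC z) L :: L₀ :: Ls)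
  have hxv : x ≠ v := hx (var v) (by simp)
  have hvs : ∀ A ∈ Ls, v ∉ FV A := fun A hA => hv A (by simp [hA])
  obtain ⟨M, hM⟩ := isStack_of_mem_WFPC hL (hx _ (by simp)) k
  obtain ⟨r, hr, hMr⟩ :=
    (((act_genFPC_conv z hLs).symm.app (.refl (var x))).trans hM).exists_steps
  obtain ⟨M, rfl⟩ := steps_iterate_app_var hMr
  have hC : ∀ P, subst (Function.update var v P) (app (apps (var v) Ls) (var x)) =
      app (apps P Ls) (var x) := by
    intro P
    rw [subst, subst_update_apps_var hvs, subst, Function.update_of_ne hxv]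
  rw [← hC] at hr
  obtain ⟨j, C', F', hC', hrC⟩ := exists_approx (hv L₀ (by simp)) hr
  obtain ⟨M, hM⟩ := steps_iterate_app_var hrC
  obtain ⟨M, rfl⟩ := eq_iterate_of_subst_loop hM
  rw [hC] at hC'
  refine ⟨j, fun A F => ⟨subst (Function.update (Function.update var x F) v A) M, ?_⟩⟩
  have h := hC'.conv.subst (Function.update (Function.update var x F) v A)
  have hfix : ∀ B ∈ L₀ :: Ls, subst (Function.update (Function.update var x F) v A) B = B := by
    intro B hB
    rw [subst_update_of_notMem (hv B hB),
      subst_update_var_of_notMem (hx B (List.mem_cons_of_mem _ (List.mem_cons_of_mem _ hB)))]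
  have e := subst_unfolding hfix j (var v)
  rw [unfolding] at e
  rw [subst, e, subst_iterate_app] at h
  simpa [subst, hxv] using h

/-- A truncation of `L * G` is convertible to an instance of a given truncation of `G`, as a long
truncation of `L` applied to `G₀` produces the required number of copies of `G₀`. -/
theorem truncation_mul_left {S : Set Term} (hconv : ∀ {P Q}, Conv P Q → P ∈ S → Q ∈ S)
    (hsubst : ∀ {P}, P ∈ S → ∀ σ, subst σ P ∈ S) {L G : Vec}
    (hL : ∀ Y ∈ FPC, act Y L ∈ WFPC) (hG : Truncation (fun _ M => M ∈ S) G) :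
    Truncation (fun _ M => M ∈ S) (L * G) := by
  cases hLs : L.toList with
  | nil =>
    have : L = 1 := hLs
    rwa [this, one_mul]
  | cons L₀ Ls =>
    obtain ⟨G₀, Gs, hGs, k, h⟩ := hG
    obtain ⟨j, hj⟩ := exists_unfolding_conv hLs (hL _ (genFPC_mem 0)) k
    refine ⟨L₀, Ls ++ G₀ :: Gs, by simp [FreeMonoid.toList_mul, hLs, hGs], j, fun z hz => ?_⟩
    have hzG : ∀ A ∈ G.toList, z ∉ FV A := fun A hA =>
      hz A (by simp [FreeMonoid.toList_mul, hA])
    obtain ⟨M, hM⟩ := hj (var z) G₀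
    have hs := hsubst (h z hzG) (Function.update var z M)
    rw [hGs] at hzG
    have e := subst_update_unfolding hzG k M
    rw [unfolding] at e
    rw [e] at hs
    refine hconv ?_ hs
    have h' := hM.symm.apps Gs
    rwa [unfolding, apps, apps, apps, ← List.foldl_cons (f := app), ← List.foldl_append] at h'

theorem IsCompactGen.act_mem {G : Vec} (hG : IsCompactGen G) {Y : Term} (hY : Y ∈ WFPC) :
    act Y G ∈ FPC :=
  truncation_act FPC_of_conv FPC_subst hG hY

end LambdaFP

open LambdaFP

theorem mainTheorem6 :
    (LambdaFP.IsMinimalIdeal LambdaFP.fgv {G | G ∈ LambdaFP.fgv ∧ LambdaFP.IsConstant G} ∧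
      LambdaFP.IsMinimalIdeal LambdaFP.wfgv {G | G ∈ LambdaFP.wfgv ∧ LambdaFP.IsConstant G}) ∧
    ((∀ G ∈ LambdaFP.wfgv, LambdaFP.IsWeaklyConstant G ↔ LambdaFP.IsWeaklyCompactGen G) ∧
      LambdaFP.IsTwoSidedIdeal LambdaFP.wfgv
        {G | G ∈ LambdaFP.wfgv ∧ LambdaFP.IsWeaklyConstant G}) ∧
    (LambdaFP.IsTwoSidedIdeal LambdaFP.fgv {G | G ∈ LambdaFP.fgv ∧ LambdaFP.IsCompactGen G} ∧
      LambdaFP.AbsorbsLeft LambdaFP.wfgv {G | G ∈ LambdaFP.fgv ∧ LambdaFP.IsCompactGen G}) := by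
  have hF : ∀ G ∈ fgv, ∀ Y ∈ FPC, act Y G ∈ WFPC := fun G hG Y hY => FPC_subset_WFPC (hG Y hY)
  have hW : ∀ G ∈ wfgv, ∀ Y ∈ FPC, act Y G ∈ WFPC := fun G hG Y hY => hG Y (FPC_subset_WFPC hY)
  refine ⟨⟨isMinimalIdeal_isConstant hF fun Y hY => ?_,
    isMinimalIdeal_isConstant hW fun Y hY => ?_⟩,
    ⟨fun G => isWeaklyConstant_iff, fun G hG => hG.1, ?_⟩, ⟨fun G hG => hG.1, ?_⟩, ?_, ?_⟩
  · exact FPC_of_conv (act_constGen (FPC_subset_WFPC hY)).symm (genFPC_mem 0)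
  · exact WFPC_of_conv (act_constGen hY).symm (FPC_subset_WFPC (genFPC_mem 0))
  · rintro G ⟨hGM, hG⟩ L hL
    have hG' := (isWeaklyConstant_iff hGM).1 hG
    have hGL := wfgv.mul_mem hGM hL
    have hLG := wfgv.mul_mem hL hGM
    exact ⟨⟨hGL, (isWeaklyConstant_iff hGL).2 (truncation_mul_right hG' hL)⟩,
      ⟨hLG, (isWeaklyConstant_iff hLG).2
        (truncation_mul_left WFPC_of_conv WFPC_subst (hW L hL) hG')⟩⟩
  · rintro G ⟨hGM, hG⟩ L hL
    exact ⟨⟨fgv.mul_mem hGM hL, truncation_mul_right hG hL⟩,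
      ⟨fgv.mul_mem hL hGM, truncation_mul_left FPC_of_conv FPC_subst (hF L hL) hG⟩⟩
  · exact fun G hG Y hY => FPC_subset_WFPC (hG.2.act_mem hY)
  · rintro L hL G ⟨-, hG⟩
    refine ⟨fun Y hY => ?_, truncation_mul_left FPC_of_conv FPC_subst (hW L hL) hG⟩
    rw [act_mul]
    exact hG.act_mem (hW L hL Y hY)
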